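/- **Setting.** Let $d\ge 1$, $n\ge 1$, $\alpha,\beta>0$, $C_1\ge 0$. Let $\sigma_0:\mathbb R\to\mathbb R$ be twice differentiable with $|\sigma_0(x)|\le C_1\max(|x|,1)$, $|\sigma_0'(x)|\le C_1$, $|\sigma_0''(x)|\le C_1$ for all $x$. For $z\in\mathbb R^d$, $\theta=(u,w,b)\in\mathbb R^d\times\mathbb R^d\times\mathbb R$ and $\omega=(a,w,b)\in\mathbb R\times\mathbb R^d\times\mathbb R$ put $$\sigma(z,\theta)=u\,\sigma_0(w^\top z+b),\qquad h(z,\omega)=a\,\sigma_0(w^\top z+b).$$ Let $x_1,\dots,x_n\in\mathbb R^d$ be training inputs with labels $y(x_i)$ such that $\|x_i\|_2=1$, $|y(x_i)|\le 1$, and $\langle x_i,x_j\rangle\le C_{\max}<1$ whenever $x_i\ne x_j$. Let $\mathcal P^2$ be the set of probability measures with finite second moment, and $\mathcal C(\mathcal P^2;[0,1])$ the set of measurable families $\nu=(\nu^s)_{s\in[0,1]}$ of probability measures on $\mathbb R^{2d+1}$ with $\sup_{s\in[0,1]}\mathbb E_{\theta\sim\nu^s}\|\theta\|_2^2<\infty$.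 For such families put $\mathcal W_2(\nu,\nu')=\sup_{s\in[0,1]}\mathcal W_2(\nu^s,\nu'^s)$ and $\mathrm{KL}(\nu\|\nu')=\int_0^1\mathrm{KL}(\nu^s\|\nu'^s)\,ds$. For $\nu\in\mathcal C(\mathcal P^2;[0,1])$ let $Z_\nu(x,\cdot)$ be the solution on $[0,1]$ of $$\frac{d z}{ds}=\alpha\int\sigma(z(s),\theta)\,d\nu^s(\theta),\qquad z(0)=x,$$ let $f_{\tau,\nu}(x)=\beta\int h(Z_\nu(x,1),\omega)\,d\tau(\omega)$, and let $p_{\nu}(x,\cdot)$ (which also depends on $\tau$) solve $$\frac{dp^\top}{ds}=-\alpha\,p^\top(s)\int\nabla_z\sigma(Z_\nu(x,s),\theta)\,d\nu^s(\theta),\qquad p(1)=\int\nabla_z h(Z_\nu(x,1),\omega)\,d\tau(\omega);$$ both equations are understood in integrated form. Let $(\tau_t,\nu_t)_{t\ge0}$, with $\tau_t\in\mathcal P^2$ on $\mathbb R^{d+2}$ and $\nu_t\in\mathcal C(\mathcal P^2;[0,1])$, be a weak solution (tested against smooth compactly supported functions) of the gradient flow $$\partial_t\tau_t=\nabla_\omega\cdot\Big(\tau_t\nabla_\omega\tfrac{\delta\widehat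 L}{\delta\tau}\Big),\qquad \partial_t\nu_t^s=\nabla_\theta\cdot\Big(\nu_t^s\nabla_\theta\tfrac{\delta\widehat L}{\delta\nu}(\cdot,s)\Big)\quad(s\in[0,1]),$$ $$\tfrac{\delta\widehat L}{\delta\tau}(\omega)=\tfrac1n\sum_{i=1}^n\beta\,(f_{\tau_t,\nu_t}(x_i)-y(x_i))\,h(Z_{\nu_t}(x_i,1),\omega),$$ $$\tfrac{\delta\widehat L}{\delta\nu}(\theta,s)=\tfrac1n\sum_{i=1}^n\beta\,(f_{\tau_t,\nu_t}(x_i)-y(x_i))\;p_{\nu_t}(x_i,s)^\top\alpha\,\sigma(Z_{\nu_t}(x_i,s),\theta),$$ started at the standard Gaussians $\tau_0=\mathcal N(0,I_{d+2})$ and $\nu_0^s=\mathcal N(0,I_{2d+1})$ for all $s\in[0,1]$. For a radius $r_{\max}$ with $0<r_{\max}\le\sqrt d$ put $$t_{\max}=\sup\Big\{t_0\ge 0:\ \max\{\mathcal W_2(\nu_t,\nu_0),\mathcal W_2(\tau_t,\tau_0)\}\le r_{\max}\ \text{ for all } t\in[0,t_0]\Big\}\in[0,\infty].$$ **Lemma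 (lower bound on the KL movement).** There is a constant $C_{\rm low}>0$ depending only on $d$, $\alpha$ and $C_1$ such that, in the setting above, for all $t\in[0,t_{\max})$ and all $x\in\mathbb R^d$ with $\|x\|_2\le 1$, $$\sqrt{\mathrm{KL}(\tau_t\|\tau_0)}+\sqrt{\mathrm{KL}(\nu_t\|\nu_0)}\ \ge\ \frac{\mathbb E_{\omega\sim\tau_t}\,h(Z_{\nu_t}(x,1),\omega)}{C_{\rm low}},$$ where the left side may be $+\infty$. -/

import Mathlib

open MeasureTheory ProbabilityTheory InformationTheory Set
open scoped ENNReal RealInnerProductSpace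

noncomputable section

namespace MeanFieldResNet

/-- The feature space `ℝᵈ` with the Euclidean norm. -/
abbrev Feat (d : ℕ) := EuclideanSpace ℝ (Fin d)

/-- Parameters `θ = (u, w, b) ∈ ℝᵈ × ℝᵈ × ℝ = ℝ^(2d+1)` of the residual blocks,
with the Euclidean norm. -/
abbrev LayerParam (d : ℕ) := EuclideanSpace ℝ (Fin d ⊕ Fin d ⊕ Unit)

/-- Parameters `ω = (a, w, b) ∈ ℝ × ℝᵈ × ℝ = ℝ^(d+2)` of the predictor,
with the Euclidean norm. -/
abbrev OutParam (d : ℕ) := EuclideanSpace ℝ (Unit ⊕ Fin d ⊕ Unit)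

/-- The residual block `σ(z, θ) = u σ₀(wᵀ z + b)`. -/
def block {d : ℕ} (σ₀ : ℝ → ℝ) (z : Feat d) (θ : LayerParam d) : Feat d :=
  σ₀ ((∑ j, θ (.inr (.inl j)) * z j) + θ (.inr (.inr ()))) •
    WithLp.toLp 2 (fun i => θ (.inl i))

/-- The predictor `h(z, ω) = a σ₀(wᵀ z + b)`. -/
def predictor {d : ℕ} (σ₀ : ℝ → ℝ) (z : Feat d) (ω : OutParam d) : ℝ :=
  ω (.inl ()) * σ₀ ((∑ j, ω (.inr (.inl j)) * z j) + ω (.inr (.inr ())))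

/-- `σ₀` is twice differentiable, `|σ₀(x)| ≤ C₁ max(|x|, 1)`, `|σ₀'| ≤ C₁` and `|σ₀''| ≤ C₁`. -/
structure IsActivation (C₁ : ℝ) (σ₀ : ℝ → ℝ) : Prop where
  differentiable : Differentiable ℝ σ₀
  differentiable_deriv : Differentiable ℝ (deriv σ₀)
  growth : ∀ x, |σ₀ x| ≤ C₁ * max |x| 1
  deriv_le : ∀ x, |deriv σ₀ x| ≤ C₁
  deriv_deriv_le : ∀ x, |deriv (deriv σ₀) x| ≤ C₁

/-- Training inputs `X₁, …, Xₙ` on the unit sphere, with labels bounded by one in absolute value;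
distinct inputs have inner product at most `Cmax < 1`. -/
structure IsDataset {d n : ℕ} (Cmax : ℝ) (X : Fin n → Feat d) (y : Feat d → ℝ) : Prop where
  norm_eq : ∀ i, ‖X i‖ = 1
  label_le : ∀ i, |y (X i)| ≤ 1
  inner_le : ∀ i j, X i ≠ X j → ⟪X i, X j⟫ ≤ Cmax
  Cmax_lt : Cmax < 1

/-- `𝒫²`: probability measures with finite second moment. -/
structure IsP2 {E : Type*} [NormedAddCommGroup E] [MeasurableSpace E] (μ : Measure E) : Prop where
  isProb : IsProbabilityMeasure μ
  second_moment : (∫⁻ v, ‖v‖ₑ ^ 2 ∂μ) < ∞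

/-- `𝒞(𝒫²; [0,1])`: measurable families `(ν^s)`, `s ∈ [0,1]`, of probability measures with
`sup_{s ∈ [0,1]} 𝔼_{θ ∼ ν^s} ‖θ‖² < ∞`. Every `𝒲₂`-continuous path in `𝒫²` is such a family.
The values of the kernel outside `[0,1]` play no role. -/
structure IsP2Path {E : Type*} [NormedAddCommGroup E] [MeasurableSpace E]
    (ν : Kernel ℝ E) : Prop where
  isMarkov : IsMarkovKernel ν
  second_moment : (⨆ s ∈ Icc (0 : ℝ) 1, ∫⁻ v, ‖v‖ₑ ^ 2 ∂(ν s)) < ∞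

/-- The 2-Wasserstein distance. -/
def W2 {E : Type*} [NormedAddCommGroup E] [MeasurableSpace E] (μ ν : Measure E) : ℝ≥0∞ :=
  (⨅ π : Measure (E × E), ⨅ _ : π.map Prod.fst = μ ∧ π.map Prod.snd = ν,
    ∫⁻ p, ‖p.1 - p.2‖ₑ ^ 2 ∂π) ^ (1 / 2 : ℝ)

/-- `𝒲₂(ν, ν') = sup_{s ∈ [0,1]} 𝒲₂(ν^s, ν'^s)` for families indexed by `s ∈ [0,1]`. -/
def W2Path {E : Type*} [NormedAddCommGroup E] [MeasurableSpace E] (ν ν' : Kernel ℝ E) : ℝ≥0∞ :=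
  ⨆ s ∈ Icc (0 : ℝ) 1, W2 (ν s) (ν' s)

/-- `KL(ν‖ν') = ∫₀¹ KL(ν^s‖ν'^s) ds`, the Kullback-Leibler divergence of the measures
`ν^s(dθ) ds` and `ν'^s(dθ) ds` on parameter space times `[0,1]`. -/
def klPath {E : Type*} [MeasurableSpace E] (ν ν' : Kernel ℝ E) : ℝ≥0∞ :=
  ∫⁻ s in Icc (0 : ℝ) 1, klDiv (ν s) (ν' s)

/-- `z` solves, on `[0,1]`, the equation `dz/ds = α ∫ σ(z(s), θ) dν^s(θ)`, `z(0) = x`,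
in integrated form. -/
def IsTrajectory {d : ℕ} (α : ℝ) (σ₀ : ℝ → ℝ) (ν : Kernel ℝ (LayerParam d)) (x : Feat d)
    (z : ℝ → Feat d) : Prop :=
  ContinuousOn z (Icc 0 1) ∧
    ∀ s ∈ Icc (0 : ℝ) 1, z s = x + α • ∫ r in (0 : ℝ)..s, ∫ θ, block σ₀ (z r) θ ∂(ν r)

open Classical in
/-- `Z_ν(x, ·)`: the solution on `[0,1]` of the ODE of `IsTrajectory`
(which exists and is unique for `ν` in `𝒞(𝒫²; [0,1])`). -/
def flow {d : ℕ} (α : ℝ) (σ₀ : ℝ → ℝ) (ν : Kernel ℝ (LayerParam d)) (x : Feat d) : ℝ → Feat d :=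
  if h : ∃ z, IsTrajectory α σ₀ ν x z then h.choose else fun _ => x

/-- The network output `f_{τ,ν}(x) = β ∫ h(Z_ν(x,1), ω) dτ(ω)`. -/
def network {d : ℕ} (α β : ℝ) (σ₀ : ℝ → ℝ) (τ : Measure (OutParam d))
    (ν : Kernel ℝ (LayerParam d)) (x : Feat d) : ℝ :=
  β * ∫ ω, predictor σ₀ (flow α σ₀ ν x 1) ω ∂τ

/-- `p` solves, on `[0,1]`, the adjoint equation
`dpᵀ/ds = -α pᵀ(s) ∫ ∇_z σ(Z_ν(x,s), θ) dν^s(θ)`, `p(1) = ∫ ∇_z h(Z_ν(x,1), ω) dτ(ω)`,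
in integrated form. The column vector of `pᵀ ∇_z σ(z, θ)` is the gradient in `z` of
`⟪p, σ(z, θ)⟫`. -/
def IsAdjoint {d : ℕ} (α : ℝ) (σ₀ : ℝ → ℝ) (τ : Measure (OutParam d))
    (ν : Kernel ℝ (LayerParam d)) (x : Feat d) (p : ℝ → Feat d) : Prop :=
  ContinuousOn p (Icc 0 1) ∧
    ∀ s ∈ Icc (0 : ℝ) 1,
      p s = (∫ ω, gradient (fun z => predictor σ₀ z ω) (flow α σ₀ ν x 1) ∂τ) +
        α • ∫ r in s..1, ∫ θ, gradient (fun z => ⟪p r, block σ₀ z θ⟫) (flow α σ₀ ν x r) ∂(ν r)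

open Classical in
/-- `p_ν(x, ·)`: the solution on `[0,1]` of the linear ODE of `IsAdjoint`
(which exists and is unique for `τ` in `𝒫²` and `ν` in `𝒞(𝒫²; [0,1])`). -/
def adjoint {d : ℕ} (α : ℝ) (σ₀ : ℝ → ℝ) (τ : Measure (OutParam d))
    (ν : Kernel ℝ (LayerParam d)) (x : Feat d) : ℝ → Feat d :=
  if h : ∃ p, IsAdjoint α σ₀ τ ν x p then h.choose else fun _ => 0

/-- The functional derivative in `τ` of the empirical squared loss:
`𝔼_{x ∼ 𝒟ₙ} [β (f_{τ,ν}(x) - y(x)) h(Z_ν(x,1), ω)]`. -/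
def lossVarTau {d n : ℕ} (α β : ℝ) (σ₀ : ℝ → ℝ) (X : Fin n → Feat d) (y : Feat d → ℝ)
    (τ : Measure (OutParam d)) (ν : Kernel ℝ (LayerParam d)) (ω : OutParam d) : ℝ :=
  (1 / (n : ℝ)) * ∑ i, β * (network α β σ₀ τ ν (X i) - y (X i)) *
    predictor σ₀ (flow α σ₀ ν (X i) 1) ω

/-- The functional derivative in `ν` of the empirical squared loss:
`𝔼_{x ∼ 𝒟ₙ} [β (f_{τ,ν}(x) - y(x)) p_ν(x,s)ᵀ α σ(Z_ν(x,s), θ)]`. -/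
def lossVarNu {d n : ℕ} (α β : ℝ) (σ₀ : ℝ → ℝ) (X : Fin n → Feat d) (y : Feat d → ℝ)
    (τ : Measure (OutParam d)) (ν : Kernel ℝ (LayerParam d)) (θ : LayerParam d) (s : ℝ) : ℝ :=
  (1 / (n : ℝ)) * ∑ i, β * (network α β σ₀ τ ν (X i) - y (X i)) *
    ⟪adjoint α σ₀ τ ν (X i) s, α • block σ₀ (flow α σ₀ ν (X i) s) θ⟫

/-- `μ` is a weak solution, for times `t ≥ 0`, of `∂ₜ μ = ∇ · (μ ∇V)` with `V` depending on time:
for each smooth compactly supported `φ`,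
`∫ φ dμ_t = ∫ φ dμ_0 - ∫₀ᵗ ∫ ⟪∇φ, ∇V_r⟫ dμ_r dr`. -/
def IsWeakSolution {E : Type*} [NormedAddCommGroup E] [InnerProductSpace ℝ E] [CompleteSpace E]
    [MeasurableSpace E] (V : ℝ → E → ℝ) (μ : ℝ → Measure E) : Prop :=
  ∀ φ : E → ℝ, ContDiff ℝ (⊤ : ℕ∞) φ → HasCompactSupport φ → ∀ t : ℝ, 0 ≤ t →
    IntervalIntegrable (fun r => ∫ v, ⟪gradient φ v, gradient (V r) v⟫ ∂(μ r)) volume 0 t ∧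
    (∫ v, φ v ∂(μ t)) = (∫ v, φ v ∂(μ 0)) -
      ∫ r in (0 : ℝ)..t, ∫ v, ⟪gradient φ v, gradient (V r) v⟫ ∂(μ r)

/-- `(τ_t, ν_t)`, `t ≥ 0`, with `τ_t ∈ 𝒫²` and `ν_t ∈ 𝒞(𝒫²; [0,1])`, solves the Wasserstein
gradient flow of the empirical loss (in `ν`, the equation holds for every layer `s ∈ [0,1]`). -/
structure IsGradientFlow {d n : ℕ} (α β : ℝ) (σ₀ : ℝ → ℝ) (X : Fin n → Feat d) (y : Feat d → ℝ)
    (τ : ℝ → Measure (OutParam d)) (ν : ℝ → Kernel ℝ (LayerParam d)) : Prop where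
  tau_mem : ∀ t, 0 ≤ t → IsP2 (τ t)
  nu_mem : ∀ t, 0 ≤ t → IsP2Path (ν t)
  tau_pde : IsWeakSolution (fun t => lossVarTau α β σ₀ X y (τ t) (ν t)) τ
  nu_pde : ∀ s ∈ Icc (0 : ℝ) 1,
    IsWeakSolution (fun t θ => lossVarNu α β σ₀ X y (τ t) (ν t) θ s) (fun t => ν t s)

/-- Standard Gaussian initialization of the predictor and of every layer. -/
structure IsGaussianInit {d : ℕ} (τ₀ : Measure (OutParam d)) (ν₀ : Kernel ℝ (LayerParam d)) :
    Prop where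
  tau_eq : τ₀ = stdGaussian (OutParam d)
  nu_eq : ∀ s ∈ Icc (0 : ℝ) 1, ν₀ s = stdGaussian (LayerParam d)

/-- `t_max = sup {t₀ ≥ 0 : max(𝒲₂(ν_t, ν_0), 𝒲₂(τ_t, τ_0)) ≤ r for all t ∈ [0, t₀]}`,
which may be infinite. -/
def tMax {d : ℕ} (r : ℝ) (τ : ℝ → Measure (OutParam d)) (ν : ℝ → Kernel ℝ (LayerParam d)) :
    EReal :=
  sSup ((fun t₀ : ℝ => (t₀ : EReal)) '' {t₀ : ℝ | 0 ≤ t₀ ∧ ∀ t ∈ Icc 0 t₀,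
    max (W2Path (ν t) (ν 0)) (W2 (τ t) (τ 0)) ≤ ENNReal.ofReal r})

end MeanFieldResNet

end

/-! The KL divergence of the predictor's law alone already dominates the output. Write `h` for
`predictor σ₀ z` with `z` the flow endpoint. Flipping the sign of the output weight preserves the
Gaussian and negates `h`, so `h` is centred under `τ 0`. Before `tMax` every layer stays within
W2-distance `√d` of the Gaussian, so its second moment is bounded, Grönwall bounds `z`, and `h`
grows at most quadratically, with a constant depending only on `d`, `α`, `C₁`.

Gaussian tails integrate `exp (c ‖v‖ ^ 2)` for some `c > 0`, so the entropy inequality gives `lam *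
∫ h dτ ≤ KL + lam ^ 2 * K` for small `lam` (`mul_integral_le_toReal_klDiv_add`). Taking `lam = √KL`
yields the square-root bound; when `√KL` is too large for that, the second moment of `τ t` bounds
the mean directly (`le_mul_sqrt_of_forall_mul_le`). -/

namespace MeanFieldResNet

/-! ### Second moments inside a Wasserstein ball. -/

section Moments

variable {E : Type*} [NormedAddCommGroup E] [MeasurableSpace E] [BorelSpace E]

lemma lintegral_enorm_sq_le_of_W2_le [SecondCountableTopology E] {μ γ : Measure E} {r : ℝ≥0∞}
    (h : W2 μ γ ≤ r) :
    ∫⁻ v, ‖v‖ₑ ^ 2 ∂μ ≤ 2 * r ^ 2 + 2 * ∫⁻ v, ‖v‖ₑ ^ 2 ∂γ := by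
  set M := ∫⁻ v, ‖v‖ₑ ^ 2 ∂γ with hM
  have hmeas : Measurable fun v : E => ‖v‖ₑ ^ 2 := by fun_prop
  -- Isolating the transport cost makes the bound uniform over couplings, so it passes to the
  -- infimum without an optimal plan.
  have key : (∫⁻ v, ‖v‖ₑ ^ 2 ∂μ - 2 * M) / 2 ≤
      ⨅ π : Measure (E × E), ⨅ _ : π.map Prod.fst = μ ∧ π.map Prod.snd = γ,
        ∫⁻ p, ‖p.1 - p.2‖ₑ ^ 2 ∂π := by
    refine le_iInf fun π => le_iInf fun hπ => ENNReal.div_le_of_le_mul' ?_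
    rw [tsub_le_iff_right, hM, ← hπ.1, ← hπ.2, lintegral_map hmeas measurable_fst,
      lintegral_map hmeas measurable_snd, ← lintegral_const_mul _ (by fun_prop),
      ← lintegral_const_mul _ (by fun_prop), ← lintegral_add_left (by fun_prop)]
    refine lintegral_mono fun p => ?_
    have h1 : ‖p.1‖ₑ ≤ ‖p.1 - p.2‖ₑ + ‖p.2‖ₑ := by
      simpa using enorm_add_le (p.1 - p.2) p.2
    calc ‖p.1‖ₑ ^ 2 ≤ (‖p.1 - p.2‖ₑ + ‖p.2‖ₑ) ^ 2 := by gcongr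
      _ ≤ 2 * (‖p.1 - p.2‖ₑ ^ 2 + ‖p.2‖ₑ ^ 2) := by
        rw [enorm_eq_nnnorm, enorm_eq_nnnorm]
        norm_cast
        rw [← NNReal.coe_le_coe]
        push_cast
        exact add_sq_le
      _ = _ := mul_add _ _ _
  have h2 : W2 μ γ ^ 2 ≤ r ^ 2 := by gcongr
  rw [W2, ← ENNReal.rpow_natCast, ← ENNReal.rpow_mul] at h2
  norm_num at h2
  have h3 := key.trans (by simpa using h2)
  rw [ENNReal.div_le_iff_le_mul (by simp) (by simp), tsub_le_iff_right, mul_comm] at h3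
  exact h3

lemma integral_one_add_norm_sq_le {μ : Measure E} [IsProbabilityMeasure μ] {S : ℝ} (hS : 0 ≤ S)
    (h : ∫⁻ v, ‖v‖ₑ ^ 2 ∂μ ≤ ENNReal.ofReal S) :
    Integrable (fun v => 1 + ‖v‖ ^ 2) μ ∧ ∫ v, (1 + ‖v‖ ^ 2) ∂μ ≤ 1 + S := by
  have hmeas : AEStronglyMeasurable (fun v : E => ‖v‖ ^ 2) μ :=
    (measurable_norm.pow_const 2).aestronglyMeasurable
  have hof : ∀ v : E, ENNReal.ofReal (‖v‖ ^ 2) = ‖v‖ₑ ^ 2 := fun v => by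
    rw [ENNReal.ofReal_pow (norm_nonneg v), ofReal_norm]
  have hint : Integrable (fun v => ‖v‖ ^ 2) μ := by
    refine ⟨hmeas, ?_⟩
    rw [hasFiniteIntegral_iff_ofReal (ae_of_all _ fun v => by positivity)]
    simp_rw [hof]
    exact h.trans_lt ENNReal.ofReal_lt_top
  refine ⟨(integrable_const 1).add hint, ?_⟩
  rw [integral_add (integrable_const 1) hint,
    integral_eq_lintegral_of_nonneg_ae (ae_of_all _ fun v => by positivity) hmeas]
  simp_rw [hof]
  have := ENNReal.toReal_mono ENNReal.ofReal_ne_top h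
  rw [ENNReal.toReal_ofReal hS] at this
  simpa using this

end Moments

/-! ### Means of centred functions against relative entropy. -/

section EntropyInequality

open Real in
/-- Young's inequality for the convex dual pair `x log x + 1 - x`, `eʸ - 1`. -/
lemma mul_le_klFun_add_exp {x : ℝ} (hx : 0 ≤ x) (y : ℝ) : x * y ≤ klFun x + (exp y - 1) := by
  rw [klFun_apply]
  rcases hx.eq_or_lt with rfl | hx
  · have := exp_pos y
    simp; linarith
  · have h1 : y - log x + 1 ≤ exp (y - log x) := add_one_le_exp _
    rw [exp_sub, exp_log hx, le_div_iff₀ hx] at h1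
    nlinarith

/-- Second-order Taylor bound: after integration the linear term vanishes by centring, leaving a
remainder quadratic in `lam`. -/
lemma exp_le_one_add_add_sq (x : ℝ) : Real.exp x ≤ 1 + x + x ^ 2 * Real.exp |x| := by
  have h := Complex.norm_exp_sub_sum_le_norm_mul_exp (x : ℂ) 2
  rw [Complex.norm_real] at h
  have h2 : |Real.exp x - (1 + x)| ≤ |x| ^ 2 * Real.exp |x| := by
    rw [← Real.norm_eq_abs, ← Real.norm_eq_abs, ← Complex.norm_real]
    simpa [Finset.sum_range_succ] using h
  rw [sq_abs] at h2
  linarith [(abs_le.mp h2).2]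

variable {Ω : Type*} [MeasurableSpace Ω]

/-- The entropy inequality for a centred function `h` with an exponential moment. -/
lemma mul_integral_le_toReal_klDiv_add {μ γ : Measure Ω} [IsProbabilityMeasure μ]
    [IsProbabilityMeasure γ] (hkl : klDiv μ γ ≠ ∞) {h : Ω → ℝ} (hμ : Integrable h μ)
    (hγ : Integrable h γ) (h0 : ∫ ω, h ω ∂γ = 0) {lam lam₀ : ℝ} (hlam : 0 ≤ lam)
    (hle : lam ≤ lam₀) (hexp : Integrable (fun ω => h ω ^ 2 * Real.exp (lam₀ * |h ω|)) γ) :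
    lam * ∫ ω, h ω ∂μ ≤
      (klDiv μ γ).toReal + lam ^ 2 * ∫ ω, h ω ^ 2 * Real.exp (lam₀ * |h ω|) ∂γ := by
  obtain ⟨hac, hllr⟩ := klDiv_ne_top_iff.mp hkl
  have hkf : Integrable (fun ω => klFun (μ.rnDeriv γ ω).toReal) γ :=
    (integrable_klFun_rnDeriv_iff hac).mpr hllr
  have hf : Integrable (fun ω => (μ.rnDeriv γ ω).toReal * h ω) γ :=
    (integrable_rnDeriv_smul_iff hac).mpr hμ
  have e1 : ∫ ω, (μ.rnDeriv γ ω).toReal * h ω ∂γ = ∫ ω, h ω ∂μ := integral_rnDeriv_smul hac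
  rw [toReal_klDiv_eq_integral_klFun hac, ← e1, ← integral_const_mul, ← integral_const_mul]
  calc ∫ ω, lam * ((μ.rnDeriv γ ω).toReal * h ω) ∂γ
      ≤ ∫ ω, (klFun (μ.rnDeriv γ ω).toReal + lam ^ 2 * (h ω ^ 2 * Real.exp (lam₀ * |h ω|)) +
          lam * h ω) ∂γ := by
        refine integral_mono (hf.const_mul _)
          ((hkf.add (hexp.const_mul _)).add (hγ.const_mul _)) fun ω => ?_
        have h1 := mul_le_klFun_add_exp (x := (μ.rnDeriv γ ω).toReal) ENNReal.toReal_nonneg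
          (lam * h ω)
        have h2 := exp_le_one_add_add_sq (lam * h ω)
        have h3 : Real.exp |lam * h ω| ≤ Real.exp (lam₀ * |h ω|) := by
          rw [abs_mul, abs_of_nonneg hlam]; gcongr
        have h4 := mul_le_mul_of_nonneg_left h3 (sq_nonneg (lam * h ω))
        simp only
        nlinarith
    _ = _ := by
        have e2 := integral_add (hkf.add (hexp.const_mul (lam ^ 2))) (hγ.const_mul lam)
        simp only [Pi.add_apply] at e2
        rw [e2, integral_add hkf (hexp.const_mul _), integral_const_mul lam, h0, mul_zero, add_zero]

/-- The choice `lam = √k` balances the two terms. If `√k > lam₀` it is not admissible, but then `B ≤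
B / lam₀ * √k`. -/
lemma le_mul_sqrt_of_forall_mul_le {H k K B lam₀ : ℝ} (hk : 0 ≤ k) (hK : 0 ≤ K) (hB : 0 ≤ B)
    (hlam₀ : 0 < lam₀) (h : ∀ lam, 0 ≤ lam → lam ≤ lam₀ → lam * H ≤ k + lam ^ 2 * K)
    (hHB : H ≤ B) : H ≤ (1 + K + B / lam₀) * √k := by
  have hs := Real.sqrt_nonneg k
  have hsq := Real.sq_sqrt hk
  have hBl : 0 ≤ B / lam₀ := by positivity
  rcases hs.eq_or_lt with h0 | hpos
  · rw [← h0, mul_zero]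
    rw [← h0] at hsq
    by_contra! hH
    -- With `k = 0` the hypothesis gives `H ≤ lam * K`, which fails for this small `lam`.
    have hm : 0 < min lam₀ (H / (2 * (K + 1))) := by positivity
    have h1 := h _ hm.le (min_le_left _ _)
    have h2 := min_le_right lam₀ (H / (2 * (K + 1)))
    rw [le_div_iff₀ (by positivity)] at h2
    have h3 : min lam₀ (H / (2 * (K + 1))) * H ≤
        min lam₀ (H / (2 * (K + 1))) * (min lam₀ (H / (2 * (K + 1))) * K) := by nlinarith
    have h4 := le_of_mul_le_mul_left h3 hm
    nlinarith
  · rcases le_or_gt (√k) lam₀ with hle | hgt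
    · have h1 := h _ hs hle
      have h2 : √k * H ≤ √k * ((1 + K) * √k) := by nlinarith
      have h3 := le_of_mul_le_mul_left h2 hpos
      nlinarith [mul_nonneg hBl hs]
    · have h1 : B ≤ B / lam₀ * √k := by
        calc B = B / lam₀ * lam₀ := by field_simp
          _ ≤ _ := by gcongr
      nlinarith [mul_nonneg hK hs]

end EntropyInequality

end MeanFieldResNet

namespace MeanFieldResNet

/-! ### Quadratic growth and Gaussian centring of the predictor. -/

section Growth

lemma norm_toLp_comp_le {ι κ : Type*} [Fintype ι] [Fintype κ] {f : ι → κ}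
    (hf : Function.Injective f) (v : EuclideanSpace ℝ κ) :
    ‖(WithLp.toLp 2 fun i => v (f i) : EuclideanSpace ℝ ι)‖ ≤ ‖v‖ := by
  rw [EuclideanSpace.norm_eq, EuclideanSpace.norm_eq]
  refine Real.sqrt_le_sqrt ?_
  calc ∑ i, ‖v (f i)‖ ^ 2 = ∑ k ∈ Finset.univ.map ⟨f, hf⟩, ‖v k‖ ^ 2 := by
        rw [Finset.sum_map]; rfl
    _ ≤ _ := Finset.sum_le_sum_of_subset_of_nonneg (Finset.subset_univ _) fun _ _ _ => by positivity

lemma IsActivation.nonneg {C₁ : ℝ} {σ₀ : ℝ → ℝ} (hσ : IsActivation C₁ σ₀) : 0 ≤ C₁ :=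
  (abs_nonneg _).trans (hσ.deriv_le 0)

lemma IsActivation.abs_neuron_le {C₁ : ℝ} {σ₀ : ℝ → ℝ} (hσ : IsActivation C₁ σ₀) {d : ℕ}
    {κ : Type*} [Fintype κ] {f : Fin d → κ} (hf : Function.Injective f) (k : κ) (z : Feat d)
    (v : EuclideanSpace ℝ κ) :
    |σ₀ ((∑ j, v (f j) * z j) + v k)| ≤ C₁ * ((‖z‖ + 1) * ‖v‖ + 1) := by
  refine (hσ.growth _).trans (mul_le_mul_of_nonneg_left (max_le ?_ ?_) hσ.nonneg)
  · have h1 : |∑ j, v (f j) * z j| ≤ ‖v‖ * ‖z‖ := by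
      have h := abs_real_inner_le_norm (WithLp.toLp 2 fun i => v (f i) : Feat d) z
      rw [PiLp.inner_apply] at h
      simp only [RCLike.inner_apply, conj_trivial, mul_comm (z _)] at h
      exact h.trans (mul_le_mul_of_nonneg_right (norm_toLp_comp_le hf v) (norm_nonneg z))
    have h2 : |v k| ≤ ‖v‖ := PiLp.norm_apply_le v k
    have h3 := abs_add_le (∑ j, v (f j) * z j) (v k)
    nlinarith
  · nlinarith [mul_nonneg (add_nonneg (norm_nonneg z) zero_le_one) (norm_nonneg v)]

lemma growth_mul_norm_le {C R a s : ℝ} (hC : 0 ≤ C) (hR : 0 ≤ R) (ha : 0 ≤ a)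
    (hs : s ≤ C * ((R + 1) * a + 1)) : s * a ≤ C * (R + 2) * (1 + a ^ 2) := by
  have h1 : a ≤ 1 + a ^ 2 := by nlinarith [sq_nonneg (a - 1)]
  have h2 : ((R + 1) * a + 1) * a ≤ (R + 2) * (1 + a ^ 2) := by nlinarith
  calc s * a ≤ C * ((R + 1) * a + 1) * a := by gcongr
    _ = C * (((R + 1) * a + 1) * a) := by ring
    _ ≤ C * ((R + 2) * (1 + a ^ 2)) := by gcongr
    _ = _ := by ring

variable {d : ℕ} {C₁ : ℝ} {σ₀ : ℝ → ℝ}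

lemma norm_block_le (hσ : IsActivation C₁ σ₀) (z : Feat d) (θ : LayerParam d) :
    ‖block σ₀ z θ‖ ≤ C₁ * (‖z‖ + 2) * (1 + ‖θ‖ ^ 2) := by
  rw [block, norm_smul, Real.norm_eq_abs]
  have h1 := hσ.abs_neuron_le (f := fun j : Fin d => (Sum.inr (Sum.inl j) : Fin d ⊕ Fin d ⊕ Unit))
    (Sum.inr_injective.comp Sum.inl_injective) (.inr (.inr ())) z θ
  refine le_trans ?_ (growth_mul_norm_le hσ.nonneg (norm_nonneg z) (norm_nonneg θ) h1)
  exact mul_le_mul_of_nonneg_left (norm_toLp_comp_le Sum.inl_injective θ) (abs_nonneg _)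

lemma abs_predictor_le (hσ : IsActivation C₁ σ₀) (z : Feat d) (ω : OutParam d) :
    |predictor σ₀ z ω| ≤ C₁ * (‖z‖ + 2) * (1 + ‖ω‖ ^ 2) := by
  rw [predictor, abs_mul, mul_comm]
  have h1 := hσ.abs_neuron_le (f := fun j : Fin d => (Sum.inr (Sum.inl j) : Unit ⊕ Fin d ⊕ Unit))
    (Sum.inr_injective.comp Sum.inl_injective) (.inr (.inr ())) z ω
  refine le_trans ?_ (growth_mul_norm_le hσ.nonneg (norm_nonneg z) (norm_nonneg ω) h1)
  exact mul_le_mul_of_nonneg_left (PiLp.norm_apply_le ω (.inl ())) (abs_nonneg _)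

lemma continuous_predictor (hσ : IsActivation C₁ σ₀) (z : Feat d) :
    Continuous (predictor σ₀ z) := by
  have := hσ.differentiable.continuous
  unfold predictor
  fun_prop

lemma integral_predictor_stdGaussian (z : Feat d) :
    ∫ ω, predictor σ₀ z ω ∂(stdGaussian (OutParam d)) = 0 := by
  -- The isometry negates only the output weight `a`, in which the predictor is odd.
  let e : OutParam d ≃ₗᵢ[ℝ] OutParam d := LinearIsometryEquiv.piLpCongrRight 2 fun k =>
    Sum.elim (fun _ => LinearIsometryEquiv.neg ℝ) (fun _ => LinearIsometryEquiv.refl ℝ ℝ) k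
  have hflip : ∀ ω, predictor σ₀ z (e ω) = -predictor σ₀ z ω := fun ω => by
    simp [predictor, e]
  have h : ∫ ω, predictor σ₀ z (e ω) ∂(stdGaussian (OutParam d)) =
      ∫ ω, predictor σ₀ z ω ∂(stdGaussian (OutParam d)) := by
    conv_rhs => rw [← stdGaussian_map e]
    exact (e.toHomeomorph.measurableEmbedding.integral_map _).symm
  simp_rw [hflip, integral_neg] at h
  linarith

end Growth

/-! ### Grönwall bound for the flow. -/

section Trajectory

/-- Maximise `g s * exp (-2 K s)`: the doubled rate makes the integral term absorb only half of the
maximum, at the price of non-sharp constants. -/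
lemma le_exp_of_le_add_mul_integral {g : ℝ → ℝ} {a K : ℝ} (ha : 0 ≤ a) (hK : 0 ≤ K)
    (hg : ContinuousOn g (Icc 0 1))
    (h : ∀ s ∈ Icc (0 : ℝ) 1, g s ≤ a + K * ∫ r in (0 : ℝ)..s, g r) :
    g 1 ≤ 2 * a * Real.exp (2 * K) := by
  obtain ⟨s, hs, hmax⟩ := isCompact_Icc.exists_isMaxOn (nonempty_Icc.mpr zero_le_one)
    (f := fun s => g s * Real.exp (-(2 * K * s))) (hg.mul (by fun_prop))
  set M := g s * Real.exp (-(2 * K * s)) with hM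
  have hle : ∀ r ∈ Icc (0 : ℝ) 1, g r ≤ M * Real.exp (2 * K * r) := fun r hr => by
    have h1 := mul_le_mul_of_nonneg_right (hmax hr) (Real.exp_pos (2 * K * r)).le
    rwa [mul_assoc, ← Real.exp_add, neg_add_cancel, Real.exp_zero, mul_one] at h1
  have hMs : M * Real.exp (2 * K * s) = g s := by
    rw [hM, mul_assoc, ← Real.exp_add]; simp
  have hderiv : ∀ r : ℝ, HasDerivAt (fun r => M / 2 * Real.exp (2 * K * r))
      (K * (M * Real.exp (2 * K * r))) r := fun r => by
    have h1 := (((hasDerivAt_id r).const_mul (2 * K)).exp).const_mul (M / 2)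
    refine h1.congr_deriv ?_
    simp only [id]; ring
  have hint : K * ∫ r in (0 : ℝ)..s, g r ≤ M / 2 * Real.exp (2 * K * s) - M / 2 := by
    calc K * ∫ r in (0 : ℝ)..s, g r ≤ K * ∫ r in (0 : ℝ)..s, M * Real.exp (2 * K * r) := by
          refine mul_le_mul_of_nonneg_left (intervalIntegral.integral_mono_on hs.1 ?_ ?_ ?_) hK
          · refine (hg.mono ?_).intervalIntegrable
            rw [uIcc_of_le hs.1]; exact Icc_subset_Icc_right hs.2
          · exact (by fun_prop : Continuous _).intervalIntegrable _ _
          · exact fun r hr => hle r ⟨hr.1, hr.2.trans hs.2⟩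
      _ = _ := by
          rw [← intervalIntegral.integral_const_mul,
            intervalIntegral.integral_eq_sub_of_hasDerivAt (fun r _ => hderiv r)
              ((by fun_prop : Continuous _).intervalIntegrable _ _)]
          simp
  have h1 := h s hs
  have h2 : M * (Real.exp (2 * K * s) + 1) ≤ 2 * a := by nlinarith
  have h3 : 1 ≤ Real.exp (2 * K * s) := Real.one_le_exp (by have := hs.1; positivity)
  have h4 : M ≤ 2 * a := by
    by_contra! hM2
    nlinarith
  have h5 := hle 1 (right_mem_Icc.mpr zero_le_one)
  rw [mul_one] at h5
  exact h5.trans (mul_le_mul_of_nonneg_right h4 (Real.exp_pos _).le)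

variable {d : ℕ} {α C₁ S : ℝ} {σ₀ : ℝ → ℝ} {ν : Kernel ℝ (LayerParam d)} {x : Feat d}

lemma IsTrajectory.norm_le (hα : 0 < α) (hσ : IsActivation C₁ σ₀) (hν : IsMarkovKernel ν)
    (hS : 0 ≤ S) (hνS : ∀ s ∈ Icc (0 : ℝ) 1, ∫⁻ θ, ‖θ‖ₑ ^ 2 ∂(ν s) ≤ ENNReal.ofReal S)
    (hx : ‖x‖ ≤ 1) {z : ℝ → Feat d} (hz : IsTrajectory α σ₀ ν x z) :
    ‖z 1‖ ≤ 6 * Real.exp (2 * (α * C₁ * (1 + S))) := by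
  have hC := hσ.nonneg
  have hcont : ContinuousOn (fun s => ‖z s‖ + 2) (Icc 0 1) := hz.1.norm.add continuousOn_const
  have hvel : ∀ r ∈ Icc (0 : ℝ) 1,
      ‖∫ θ, block σ₀ (z r) θ ∂(ν r)‖ ≤ C₁ * (1 + S) * (‖z r‖ + 2) := fun r hr => by
    obtain ⟨hi, hb⟩ := integral_one_add_norm_sq_le hS (hνS r hr)
    calc ‖∫ θ, block σ₀ (z r) θ ∂(ν r)‖
        ≤ ∫ θ, C₁ * (‖z r‖ + 2) * (1 + ‖θ‖ ^ 2) ∂(ν r) :=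
          norm_integral_le_of_norm_le (hi.const_mul _) (ae_of_all _ fun θ => norm_block_le hσ _ _)
      _ ≤ C₁ * (‖z r‖ + 2) * (1 + S) := by
          rw [integral_const_mul]; gcongr
      _ = _ := by ring
  -- The shift by 2 makes the velocity bound homogeneous in `g`; `a = 3` bounds `‖x‖ + 2`.
  have key := le_exp_of_le_add_mul_integral (g := fun s => ‖z s‖ + 2) (a := 3)
    (K := α * C₁ * (1 + S)) (by norm_num) (by positivity) hcont fun s hs => by
      have hint : IntervalIntegrable (fun r => ‖z r‖ + 2) volume 0 s := by
        refine (hcont.mono ?_).intervalIntegrable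
        rw [uIcc_of_le hs.1]; exact Icc_subset_Icc_right hs.2
      have h1 : ‖∫ r in (0 : ℝ)..s, ∫ θ, block σ₀ (z r) θ ∂(ν r)‖ ≤
          ∫ r in (0 : ℝ)..s, C₁ * (1 + S) * (‖z r‖ + 2) :=
        intervalIntegral.norm_integral_le_of_norm_le hs.1
          (ae_of_all _ fun r hr => hvel r ⟨hr.1.le, hr.2.trans hs.2⟩) (hint.const_mul _)
      rw [intervalIntegral.integral_const_mul] at h1
      have h2 : ‖z s‖ ≤ ‖x‖ + α * ‖∫ r in (0 : ℝ)..s, ∫ θ, block σ₀ (z r) θ ∂(ν r)‖ := by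
        conv_lhs => rw [hz.2 s hs]
        refine (norm_add_le _ _).trans_eq ?_
        rw [norm_smul, Real.norm_eq_abs, abs_of_pos hα]
      have h3 := mul_le_mul_of_nonneg_left h1 hα.le
      linarith
  linarith

lemma norm_flow_one_le (hα : 0 < α) (hσ : IsActivation C₁ σ₀) (hν : IsMarkovKernel ν)
    (hS : 0 ≤ S) (hνS : ∀ s ∈ Icc (0 : ℝ) 1, ∫⁻ θ, ‖θ‖ₑ ^ 2 ∂(ν s) ≤ ENNReal.ofReal S)
    (hx : ‖x‖ ≤ 1) : ‖flow α σ₀ ν x 1‖ ≤ 6 * Real.exp (2 * (α * C₁ * (1 + S))) := by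
  unfold flow
  split_ifs with h
  · exact h.choose_spec.norm_le hα hσ hν hS hνS hx
  -- Without a trajectory, `flow` defaults to the constant `x`, which obeys the same bound.
  · have := hσ.nonneg
    have h1 : 1 ≤ Real.exp (2 * (α * C₁ * (1 + S))) := Real.one_le_exp (by positivity)
    linarith

end Trajectory

/-! ### Uniform constants and the Gaussian entropy bound. -/

/-- A bound for the second moment of every measure within `𝒲₂`-distance `√d` of the standard
Gaussian on `E`. -/
noncomputable def momentBound (d : ℕ) (E : Type*) [NormedAddCommGroup E] [InnerProductSpace ℝ E]
    [FiniteDimensional ℝ E] [MeasurableSpace E] [BorelSpace E] : ℝ :=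
  2 * d + 2 * (∫⁻ v, ‖v‖ₑ ^ 2 ∂(stdGaussian E)).toReal

section

variable {E : Type*} [NormedAddCommGroup E] [InnerProductSpace ℝ E] [FiniteDimensional ℝ E]
  [MeasurableSpace E] [BorelSpace E]

lemma momentBound_nonneg (d : ℕ) : 0 ≤ momentBound d E := by unfold momentBound; positivity

lemma lintegral_enorm_sq_le_momentBound {d : ℕ} {μ : Measure E} {r : ℝ} (hr : r ≤ √d)
    (h : W2 μ (stdGaussian E) ≤ ENNReal.ofReal r) :
    ∫⁻ v, ‖v‖ₑ ^ 2 ∂μ ≤ ENNReal.ofReal (momentBound d E) := by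
  have hfin : ∫⁻ v, ‖v‖ₑ ^ 2 ∂(stdGaussian E) ≠ ∞ := by
    have h1 := (IsGaussian.memLp_two_id (μ := stdGaussian E)).2
    rw [eLpNorm_lt_top_iff_lintegral_rpow_enorm_lt_top (by simp) (by simp)] at h1
    simpa using h1.ne
  refine (lintegral_enorm_sq_le_of_W2_le h).trans ?_
  rw [momentBound, ENNReal.ofReal_add (by positivity) (by positivity),
    ENNReal.ofReal_mul (by norm_num), ENNReal.ofReal_mul (by norm_num), ENNReal.ofReal_toReal hfin,
    ENNReal.ofReal_ofNat, ← Real.sq_sqrt (Nat.cast_nonneg d),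
    ENNReal.ofReal_pow (Real.sqrt_nonneg _)]
  gcongr

end

lemma le_of_lt_tMax {d : ℕ} {r t : ℝ} {τ : ℝ → Measure (OutParam d)}
    {ν : ℝ → Kernel ℝ (LayerParam d)} (ht : 0 ≤ t) (h : (t : EReal) < tMax r τ ν) :
    W2 (τ t) (τ 0) ≤ ENNReal.ofReal r ∧
      ∀ s ∈ Icc (0 : ℝ) 1, W2 (ν t s) (ν 0 s) ≤ ENNReal.ofReal r := by
  obtain ⟨_, ⟨t₀, ⟨-, h₀⟩, rfl⟩, hlt⟩ := lt_sSup_iff.mp h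
  have h1 := h₀ t ⟨ht, (EReal.coe_lt_coe_iff.mp hlt).le⟩
  refine ⟨(le_max_right _ _).trans h1, fun s hs => ?_⟩
  exact (le_iSup₂ (f := fun s (_ : s ∈ Icc (0 : ℝ) 1) => W2 (ν t s) (ν 0 s)) s hs).trans
    ((le_max_left _ _).trans h1)

/-- A function of quadratic growth, centred under the standard Gaussian, has a mean under `μ`
controlled by the square root of the relative entropy of `μ`. -/
lemma exists_integral_le_mul_sqrt_klDiv (E : Type*) [NormedAddCommGroup E] [InnerProductSpace ℝ E]
    [FiniteDimensional ℝ E] [MeasurableSpace E] [BorelSpace E] {A S : ℝ} (hA : 0 < A)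
    (hS : 0 ≤ S) :
    ∃ C : ℝ, 0 < C ∧ ∀ (h : E → ℝ), Continuous h → (∀ v, |h v| ≤ A * (1 + ‖v‖ ^ 2)) →
      ∫ v, h v ∂(stdGaussian E) = 0 → ∀ (μ : Measure E), IsProbabilityMeasure μ →
      ∫⁻ v, ‖v‖ₑ ^ 2 ∂μ ≤ ENNReal.ofReal S → klDiv μ (stdGaussian E) ≠ ∞ →
      ∫ v, h v ∂μ ≤ C * √(klDiv μ (stdGaussian E)).toReal := by
  obtain ⟨c, hc, hint⟩ := IsGaussian.exists_integrable_exp_sq (stdGaussian E)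
  -- The factor 2 leaves room for two copies of `exp (lam₀ * |h|)`: the explicit weight, and one
  -- absorbing `h ^ 2`.
  set lam₀ := c / (2 * A) with hlam₀
  have hlam₀_pos : 0 < lam₀ := by positivity
  set K := ∫ v, 2 / lam₀ ^ 2 * Real.exp c * Real.exp (c * ‖v‖ ^ 2) ∂(stdGaussian E) with hK
  have hK0 : 0 ≤ K := integral_nonneg fun v => by positivity
  refine ⟨1 + K + A * (1 + S) / lam₀, by positivity, fun h hcont hgrowth h0 μ hμ hμS hkl => ?_⟩
  obtain ⟨hi, hb⟩ := integral_one_add_norm_sq_le hS hμS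
  have hμh : Integrable h μ :=
    (hi.const_mul A).mono' hcont.aestronglyMeasurable (ae_of_all _ hgrowth)
  have hexp : ∀ v, h v ^ 2 * Real.exp (lam₀ * |h v|) ≤
      2 / lam₀ ^ 2 * Real.exp c * Real.exp (c * ‖v‖ ^ 2) := fun v => by
    have hp : 0 ≤ lam₀ * |h v| := by positivity
    have h1 : (lam₀ * |h v|) ^ 2 ≤ 2 * Real.exp (lam₀ * |h v|) := by
      linarith [Real.quadratic_le_exp_of_nonneg hp]
    have h2 : h v ^ 2 ≤ 2 / lam₀ ^ 2 * Real.exp (lam₀ * |h v|) := by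
      rw [mul_pow, sq_abs] at h1
      rw [div_mul_eq_mul_div, le_div_iff₀ (by positivity)]
      linarith
    have h3 : lam₀ * |h v| + lam₀ * |h v| ≤ c + c * ‖v‖ ^ 2 := by
      have h4 := mul_le_mul_of_nonneg_left (hgrowth v) hlam₀_pos.le
      have h5 : lam₀ * (A * (1 + ‖v‖ ^ 2)) = (c + c * ‖v‖ ^ 2) / 2 := by
        rw [hlam₀]; field_simp
      linarith
    calc h v ^ 2 * Real.exp (lam₀ * |h v|)
        ≤ 2 / lam₀ ^ 2 * Real.exp (lam₀ * |h v|) * Real.exp (lam₀ * |h v|) := by gcongr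
      _ = 2 / lam₀ ^ 2 * Real.exp (lam₀ * |h v| + lam₀ * |h v|) := by rw [Real.exp_add]; ring
      _ ≤ 2 / lam₀ ^ 2 * Real.exp (c + c * ‖v‖ ^ 2) := by gcongr
      _ = _ := by rw [Real.exp_add]; ring
  have hmaj := hint.const_mul (2 / lam₀ ^ 2 * Real.exp c)
  have hexp_int : Integrable (fun v => h v ^ 2 * Real.exp (lam₀ * |h v|)) (stdGaussian E) := by
    refine hmaj.mono' (by fun_prop) (ae_of_all _ fun v => ?_)
    rw [Real.norm_of_nonneg (by positivity)]
    exact hexp v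
  have hγh : Integrable h (stdGaussian E) := by
    refine (hint.const_mul (A * (1 + 1 / c))).mono' hcont.aestronglyMeasurable
      (ae_of_all _ fun v => (hgrowth v).trans ?_)
    rw [mul_assoc]
    have h1 := Real.add_one_le_exp (c * ‖v‖ ^ 2)
    have h2 : 1 + ‖v‖ ^ 2 ≤ (1 + 1 / c) * (c * ‖v‖ ^ 2 + 1) := by
      have : (1 + 1 / c) * (c * ‖v‖ ^ 2 + 1) = 1 + ‖v‖ ^ 2 + c * ‖v‖ ^ 2 + 1 / c := by
        field_simp; ring
      have : 0 ≤ c * ‖v‖ ^ 2 + 1 / c := by positivity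
      linarith
    exact mul_le_mul_of_nonneg_left (h2.trans (by gcongr)) hA.le
  refine le_mul_sqrt_of_forall_mul_le ENNReal.toReal_nonneg hK0 (by positivity) hlam₀_pos
    (fun lam hl hle => ?_) ?_
  · refine (mul_integral_le_toReal_klDiv_add hkl hμh hγh h0 hl hle hexp_int).trans ?_
    gcongr
    exact integral_mono hexp_int hmaj hexp
  · calc ∫ v, h v ∂μ ≤ ∫ v, A * (1 + ‖v‖ ^ 2) ∂μ :=
          integral_mono hμh (hi.const_mul A) fun v => (le_abs_self _).trans (hgrowth v)
      _ ≤ A * (1 + S) := by rw [integral_const_mul]; gcongr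

end MeanFieldResNet

open MeanFieldResNet in
theorem mainTheorem9 (d : ℕ) (α C₁ : ℝ) (hα : 0 < α) :
    ∃ Clow : ℝ, 0 < Clow ∧
      ∀ (σ₀ : ℝ → ℝ), MeanFieldResNet.IsActivation C₁ σ₀ →
      ∀ (n : ℕ), 0 < n →
      ∀ (Cmax : ℝ) (X : Fin n → MeanFieldResNet.Feat d) (y : MeanFieldResNet.Feat d → ℝ),
        MeanFieldResNet.IsDataset Cmax X y →
      ∀ (β : ℝ), 0 < β →
      ∀ (τ : ℝ → Measure (MeanFieldResNet.OutParam d))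
        (ν : ℝ → Kernel ℝ (MeanFieldResNet.LayerParam d)),
        MeanFieldResNet.IsGradientFlow α β σ₀ X y τ ν →
        MeanFieldResNet.IsGaussianInit (τ 0) (ν 0) →
      ∀ (rmax : ℝ), 0 < rmax → rmax ≤ Real.sqrt d →
      ∀ (t : ℝ), 0 ≤ t → (t : EReal) < MeanFieldResNet.tMax rmax τ ν →
      ∀ (x : MeanFieldResNet.Feat d), ‖x‖ ≤ 1 →
        ENNReal.ofReal
            ((∫ ω, MeanFieldResNet.predictor σ₀ (MeanFieldResNet.flow α σ₀ (ν t) x 1) ω ∂(τ t)) /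
              Clow)
          ≤ (klDiv (τ t) (τ 0)) ^ (1 / 2 : ℝ) +
            (MeanFieldResNet.klPath (ν t) (ν 0)) ^ (1 / 2 : ℝ) := by
  set S := momentBound d (LayerParam d) with hS
  -- `A` is fixed before any activation supplies `0 ≤ C₁`, hence the absolute values; the added 1
  -- keeps it positive.
  set A := |C₁| * (6 * Real.exp (2 * (α * |C₁| * (1 + S))) + 2) + 1 with hA
  have hA_pos : 0 < A := by positivity
  obtain ⟨C, hC, hbound⟩ := exists_integral_le_mul_sqrt_klDiv (OutParam d) hA_pos
    (momentBound_nonneg (E := OutParam d) d)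
  refine ⟨C, hC, fun σ₀ hσ n _ Cmax X y _ β _ τ ν hflow hinit r _ hr t ht htmax x hx => ?_⟩
  -- The layer KL term is discarded.
  refine le_trans ?_ le_self_add
  obtain ⟨hτr, hνr⟩ := le_of_lt_tMax ht htmax
  rw [hinit.tau_eq] at hτr ⊢
  rcases eq_or_ne (klDiv (τ t) (stdGaussian (OutParam d))) ∞ with htop | htop
  · rw [htop, ENNReal.top_rpow_of_pos (by norm_num)]
    exact le_top
  have hz := norm_flow_one_le hα hσ (hflow.nu_mem t ht).isMarkov
    (momentBound_nonneg (E := LayerParam d) d) (fun s hs => by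
      have h1 := hνr s hs
      rw [hinit.nu_eq s hs] at h1
      exact lintegral_enorm_sq_le_momentBound hr h1) hx
  have hgrowth : ∀ ω, |predictor σ₀ (flow α σ₀ (ν t) x 1) ω| ≤ A * (1 + ‖ω‖ ^ 2) := fun ω => by
    refine (abs_predictor_le hσ _ ω).trans ?_
    have := hσ.nonneg
    gcongr
    rw [hA, abs_of_nonneg hσ.nonneg]
    refine le_trans ?_ (le_add_of_nonneg_right zero_le_one)
    gcongr
  have key := hbound _ (continuous_predictor hσ _) hgrowth (integral_predictor_stdGaussian _) (τ t)
    (hflow.tau_mem t ht).isProb (lintegral_enorm_sq_le_momentBound hr hτr) htop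
  calc _ ≤ ENNReal.ofReal √(klDiv (τ t) (stdGaussian (OutParam d))).toReal := by
        refine ENNReal.ofReal_le_ofReal ?_
        rwa [div_le_iff₀' hC]
    _ = _ := by
        rw [Real.sqrt_eq_rpow, ← ENNReal.ofReal_rpow_of_nonneg ENNReal.toReal_nonneg (by norm_num),
          ENNReal.ofReal_toReal htop]
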